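/- For $K>1$ and integers $s\ge 1$ put $\alpha_s(K)=\dfrac{2Ks+1}{2K(s-1)+1}$, and let $S_K$ be the weighted forward shift on $\ell^2(\mathbb{N},\mathbb{C})$ given by $$S_K(z_0,z_1,z_2,\dots)=(0,\alpha_1(K)z_0,\alpha_2(K)z_1,\dots).$$ **Theorem.** Let $K>1$. (1) If $T$ is a bounded linear operator on a complex Hilbert space $\mathcal H$ with $\|T^n\|\le K$ for every $n\ge 0$, then $\|p(T)\|\le\|p(S_K)\|$ for every polynomial $p$ with complex coefficients. (2) There is no power bounded weighted forward shift $E$ (that is, an operator on $\ell^2(\mathbb{N},\mathbb{C})$ of the form $E(z_0,z_1,\dots)=(0,w_0z_0,w_1z_1,\dots)$ with bounded complex weights $(w_n)_{n\ge 0}$ and $\sup_{n\ge 0}\|E^n\|<\infty$) such that $\|f(A)\|\le\|f(E)\|$ holds for every bounded linear operator $A$ on every complex Hilbert space with $\sup_{n\ge 0}\|A^n\|\le K$ and every complex polynomial $f$. -/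

import Mathlib

open scoped ENNReal
open Polynomial

universe u

/-- The Hilbert space of square-summable complex sequences `(z 0, z 1, z 2, …)`. -/
abbrev EllTwo : Type := lp (fun _ : ℕ => ℂ) 2

/-- The sequence `(0, w 0 * z 0, w 1 * z 1, …)`. -/
def shiftSeq (w z : ℕ → ℂ) : ℕ → ℂ
  | 0 => 0
  | n + 1 => w n * z n

lemma summable_sq_ellTwo (z : EllTwo) : Summable fun n => ‖z n‖ ^ (2 : ℝ) := by
  have h := lp.memℓp z
  rw [memℓp_gen_iff (by norm_num)] at h
  simpa using h

lemma norm_shiftSeq_succ_le {w : ℕ → ℂ} {C : ℝ} (hC : ∀ n, ‖w n‖ ≤ C) (z : ℕ → ℂ) (n : ℕ) :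
    ‖shiftSeq w z (n + 1)‖ ^ (2 : ℝ) ≤ C ^ (2 : ℝ) * ‖z n‖ ^ (2 : ℝ) := by
  have hC0 : 0 ≤ C := (norm_nonneg _).trans (hC 0)
  rw [← Real.mul_rpow hC0 (norm_nonneg _)]
  refine Real.rpow_le_rpow (norm_nonneg _) ?_ (by norm_num)
  simpa [shiftSeq] using mul_le_mul_of_nonneg_right (hC n) (norm_nonneg (z n))

lemma summable_shiftSeq {w : ℕ → ℂ} {C : ℝ} (hC : ∀ n, ‖w n‖ ≤ C) (z : EllTwo) :
    Summable fun n => ‖shiftSeq w z n‖ ^ (2 : ℝ) := by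
  rw [← summable_nat_add_iff 1]
  exact Summable.of_nonneg_of_le (fun n => by positivity)
    (fun n => norm_shiftSeq_succ_le hC z n) ((summable_sq_ellTwo z).mul_left _)

lemma memℓp_shiftSeq {w : ℕ → ℂ} (hw : ∃ C : ℝ, ∀ n, ‖w n‖ ≤ C) (z : EllTwo) :
    Memℓp (shiftSeq w z) 2 := by
  obtain ⟨C, hC⟩ := hw
  rw [memℓp_gen_iff (by norm_num)]
  simpa using summable_shiftSeq hC z

/-- The weighted forward shift on `ℓ²` as a linear map, for a bounded weight sequence. -/
def weightedForwardShiftLin (w : ℕ → ℂ) (hw : ∃ C : ℝ, ∀ n, ‖w n‖ ≤ C) :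
    EllTwo →ₗ[ℂ] EllTwo where
  toFun z := ⟨shiftSeq w z, memℓp_shiftSeq hw z⟩
  map_add' x y := by
    ext n
    cases n with
    | zero => exact (add_zero (0 : ℂ)).symm
    | succ n => exact mul_add (w n) (x n) (y n)
  map_smul' c x := by
    ext n
    cases n with
    | zero => exact (mul_zero c).symm
    | succ n => exact mul_left_comm (w n) c (x n)

lemma weightedForwardShiftLin_bound (w : ℕ → ℂ) (hw : ∃ C : ℝ, ∀ n, ‖w n‖ ≤ C) :
    ∃ C : ℝ, ∀ z, ‖weightedForwardShiftLin w hw z‖ ≤ C * ‖z‖ := by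
  obtain ⟨C, hC⟩ := hw
  have hC0 : 0 ≤ C := (norm_nonneg _).trans (hC 0)
  refine ⟨C, fun z => ?_⟩
  refine lp.norm_le_of_tsum_le (by norm_num) (by positivity) ?_
  have h2 : ((2 : ℝ≥0∞).toReal) = (2 : ℝ) := by norm_num
  have hz := lp.norm_rpow_eq_tsum (p := 2) (by norm_num) z
  rw [h2] at hz ⊢
  change ∑' n, ‖shiftSeq w z n‖ ^ (2 : ℝ) ≤ _
  rw [Real.mul_rpow hC0 (norm_nonneg _), hz, (summable_shiftSeq hC z).tsum_eq_zero_add,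
    ← tsum_mul_left]
  have h0 : ‖shiftSeq w z 0‖ ^ (2 : ℝ) = 0 := by simp [shiftSeq]
  rw [h0, zero_add]
  exact Summable.tsum_le_tsum (fun n => norm_shiftSeq_succ_le hC z n)
    ((summable_nat_add_iff 1).2 (summable_shiftSeq hC z)) ((summable_sq_ellTwo z).mul_left _)

/-- The weighted forward shift `(z 0, z 1, …) ↦ (0, w 0 * z 0, w 1 * z 1, …)` on `ℓ²`, as a bounded
operator. Boundedness of the weights is exactly what makes it a bounded operator. -/
noncomputable def weightedForwardShift (w : ℕ → ℂ) (hw : ∃ C : ℝ, ∀ n, ‖w n‖ ≤ C) :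
    EllTwo →L[ℂ] EllTwo :=
  (weightedForwardShiftLin w hw).mkContinuousOfExistsBound (weightedForwardShiftLin_bound w hw)

/-- `α_s(K) = (2 K s + 1) / (2 K (s - 1) + 1)`, used for integers `s ≥ 1`. -/
noncomputable def shiftAlpha (K : ℝ) (s : ℕ) : ℝ :=
  (2 * K * (s : ℝ) + 1) / (2 * K * ((s : ℝ) - 1) + 1)

lemma shiftAlpha_bounded {K : ℝ} (hK : 1 < K) :
    ∃ C : ℝ, ∀ n : ℕ, ‖((shiftAlpha K (n + 1) : ℝ) : ℂ)‖ ≤ C := by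
  refine ⟨2 * K + 1, fun n => ?_⟩
  have hn : (0 : ℝ) ≤ n := n.cast_nonneg
  have hKn : 0 ≤ K * n := by positivity
  have hKKn : 0 ≤ K * (K * n) := by positivity
  have hd : 0 < 2 * K * (((n + 1 : ℕ) : ℝ) - 1) + 1 := by push_cast; nlinarith
  have hnum : 0 ≤ 2 * K * ((n + 1 : ℕ) : ℝ) + 1 := by push_cast; nlinarith
  rw [Complex.norm_real, shiftAlpha, Real.norm_of_nonneg (div_nonneg hnum hd.le), div_le_iff₀ hd]
  push_cast
  nlinarith

/-- The operator `S_K (z 0, z 1, …) = (0, α_1(K) * z 0, α_2(K) * z 1, …)` on `ℓ²`. -/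
noncomputable def extremalShift (K : ℝ) (hK : 1 < K) : EllTwo →L[ℂ] EllTwo :=
  weightedForwardShift (fun n => ((shiftAlpha K (n + 1) : ℝ) : ℂ)) (shiftAlpha_bounded hK)

/-- `E` is a (unilateral, scalar) weighted forward shift on `ℓ²`: it has the form
`(z 0, z 1, …) ↦ (0, w 0 * z 0, w 1 * z 1, …)` for some bounded complex weights. -/
def IsWeightedForwardShift (E : EllTwo →L[ℂ] EllTwo) : Prop :=
  ∃ (w : ℕ → ℂ) (hw : ∃ C : ℝ, ∀ n, ‖w n‖ ≤ C), E = weightedForwardShift w hw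

/-- `A` is power bounded: the norms of its powers are uniformly bounded. -/
def IsPowerBounded {H : Type*} [NormedAddCommGroup H] [InnerProductSpace ℂ H]
    (A : H →L[ℂ] H) : Prop :=
  ∃ M : ℝ, ∀ n : ℕ, ‖A ^ n‖ ≤ M

/-! Both parts rest on a backward-shift model. Suppose `D` and weights `b` are such that `∑ (‖D T*ⁿ
h‖ / b n) ^ 2` is comparable to `‖h‖ ^ 2`. Then `h ↦ (D T*ⁿ h / b n)ₙ` intertwines `T*` with copies
of the adjoint of the weighted shift with weights `b (n + 1) / b n`, so polynomials in `T` are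
controlled by that shift (`norm_aeval_le_of_shift_model`).

Part (1): take `b n = 2 K n + 1` and `a n = (b n)⁻²`. As `a` is log-convex, Kaluza's lemma gives `1
/ ∑ a n xⁿ = 1 - ∑ c m xᵐ⁺¹` with `c ≥ 0`. Since `c n ≤ a (n + 1)`, also `K² ∑ c m < 1`, which makes
`1 - ∑ c m Tᵐ⁺¹ T*ᵐ⁺¹` positive. With `D` its square root, the model is isometric
(`hasSum_renewal`).

Part (2): for a power bounded weighted shift `E` and `r < 1`, a diagonal renorming turns the adjoint
of `r E` into a contraction, so `‖p(r E)‖ ≤ M ‖p(S)‖ ≤ M sup |p|` over the unit circle, where `S` is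
the unilateral shift. A Foguel–Hankel operator with power bound `K` violates every such estimate: a
matrix entry of `p` at it is `δ ∑ p.coeff (4 ^ k)`, and Rudin–Shapiro type polynomials make this sum
of order `√m` while `|p| ≤ 2` on the circle. -/

section

open scoped InnerProductSpace

/-! ### Polynomial calculus and coordinates of weighted shifts -/

lemma LinearMap.map_aeval_of_comm {M N : Type*} [AddCommGroup M] [Module ℂ M] [AddCommGroup N]
    [Module ℂ N] (L : M →ₗ[ℂ] N) (A : Module.End ℂ M) (B : Module.End ℂ N)
    (h : ∀ x, L (A x) = B (L x)) (p : ℂ[X]) (x : M) :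
    L (aeval A p x) = aeval B p (L x) := by
  induction p using Polynomial.induction_on' generalizing x with
  | add p q hp hq => simp [hp, hq]
  | monomial n a =>
    have hn : ∀ n x, L ((A ^ n) x) = (B ^ n) (L x) := by
      intro n
      induction n with
      | zero => simp
      | succ n ih => intro x; simp [pow_succ, ih, h]
    simp [aeval_monomial, hn]

lemma ContinuousLinearMap.coe_aeval_apply {H : Type*} [NormedAddCommGroup H] [NormedSpace ℂ H]
    (A : H →L[ℂ] H) (p : ℂ[X]) (x : H) :
    aeval A p x = aeval (A : Module.End ℂ H) p x := by
  induction p using Polynomial.induction_on' with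
  | add p q hp hq => simp [hp, hq]
  | monomial n a =>
    have hn : ∀ n x, (A ^ n) x = ((A : Module.End ℂ H) ^ n) x := by
      intro n
      induction n with
      | zero => simp
      | succ n ih => intro x; simp [pow_succ, ih]
    simp [aeval_monomial, hn]

lemma LinearMap.map_aeval_of_commL {H G : Type*} [NormedAddCommGroup H] [NormedSpace ℂ H]
    [NormedAddCommGroup G] [NormedSpace ℂ G] (L : H →ₗ[ℂ] G) (A : H →L[ℂ] H) (B : G →L[ℂ] G)
    (h : ∀ x, L (A x) = B (L x)) (p : ℂ[X]) (x : H) :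
    L (aeval A p x) = aeval B p (L x) := by
  rw [ContinuousLinearMap.coe_aeval_apply, ContinuousLinearMap.coe_aeval_apply]
  exact LinearMap.map_aeval_of_comm L _ _ h p x

lemma star_aeval_eq_aeval_star {A : Type*} [Ring A] [StarRing A] [Algebra ℂ A] [StarModule ℂ A]
    (T : A) (p : ℂ[X]) : star (aeval T p) = aeval (star T) (p.map (starRingEnd ℂ)) := by
  induction p using Polynomial.induction_on' with
  | add p q hp hq => simp [hp, hq]
  | monomial n a =>
    rw [Polynomial.map_monomial, aeval_monomial, aeval_monomial, star_mul, star_pow,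
      ← algebraMap_star_comm, Algebra.commutes]
    rfl

lemma lp.norm_sq_eq_tsum (z : EllTwo) : ‖z‖ ^ 2 = ∑' n, ‖z n‖ ^ 2 := by
  have := lp.norm_rpow_eq_tsum (p := 2) (by norm_num) z
  simpa using this

lemma lp.hasSum_norm_sq (z : EllTwo) : HasSum (fun n => ‖z n‖ ^ 2) (‖z‖ ^ 2) := by
  have := lp.hasSum_norm (p := 2) (by norm_num) z
  simpa using this

@[simp] lemma weightedForwardShift_apply_zero (w : ℕ → ℂ) (hw) (z : EllTwo) :
    weightedForwardShift w hw z 0 = 0 := rfl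

@[simp] lemma weightedForwardShift_apply_succ (w : ℕ → ℂ) (hw) (z : EllTwo) (n : ℕ) :
    weightedForwardShift w hw z (n + 1) = w n * z n := rfl

lemma weightedForwardShift_single (w : ℕ → ℂ) (hw) (n : ℕ) (a : ℂ) :
    weightedForwardShift w hw (lp.single 2 n a) = lp.single 2 (n + 1) (w n * a) := by
  ext k
  cases k with
  | zero => simp [lp.single_apply]
  | succ k =>
    by_cases h : k = n
    · subst h; simp
    · simp [lp.single_apply, h]

@[simp] lemma weightedForwardShift_adjoint_apply (w : ℕ → ℂ) (hw) (z : EllTwo) (n : ℕ) :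
    (weightedForwardShift w hw).adjoint z n = starRingEnd ℂ (w n) * z (n + 1) := by
  have h := ContinuousLinearMap.adjoint_inner_right (weightedForwardShift w hw)
    (lp.single 2 n (1 : ℂ)) z
  rw [weightedForwardShift_single, lp.inner_single_left, lp.inner_single_left] at h
  simpa [mul_comm] using h

/-- A complex sequence dominated by a square summable one belongs to `ℓ²`. -/
lemma memlp_two_of_norm_le {x : ℕ → ℂ} {y : ℕ → ℝ} (hy : Summable fun n => y n ^ 2)
    (h : ∀ n, ‖x n‖ ≤ y n) : Memℓp x 2 := by
  rw [memℓp_gen_iff (by norm_num)]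
  have : Summable fun n => ‖x n‖ ^ 2 :=
    Summable.of_nonneg_of_le (fun n => by positivity) (fun n => by gcongr; exact h n) hy
  simpa using this

/-! ### Backward-shift models -/

lemma HilbertBasis.tsum_ofReal_norm_sq {ι F : Type*} [NormedAddCommGroup F]
    [InnerProductSpace ℂ F] (e : HilbertBasis ι ℂ F) (x : F) :
    ∑' i, ENNReal.ofReal (‖⟪e i, x⟫_ℂ‖ ^ 2) = ENNReal.ofReal (‖x‖ ^ 2) := by
  have h := lp.hasSum_norm (p := 2) (by norm_num) (e.repr x)
  simp only [ENNReal.toReal_ofNat, Real.rpow_ofNat, LinearIsometryEquiv.norm_map,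
    HilbertBasis.repr_apply_apply] at h
  rw [← ENNReal.ofReal_tsum_of_nonneg (fun i => by positivity) h.summable, h.tsum_eq]

/-- A Hilbert basis of `F` splits the vector-valued model into scalar maps `L i`, each intertwining
`T*` with the adjoint shift. Hence `N` grows by at most `‖p(W)‖ ^ 2` under `p(T)*`, and comparing
`N` with the norm costs the factor `M / m`. Sums are taken in `ℝ≥0∞` so that they may be
interchanged freely. -/
theorem norm_aeval_le_of_shift_model {H F : Type*} [NormedAddCommGroup H] [InnerProductSpace ℂ H]
    [CompleteSpace H] [NormedAddCommGroup F] [InnerProductSpace ℂ F] [CompleteSpace F]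
    (T : H →L[ℂ] H) (D : H →L[ℂ] F) (b : ℕ → ℝ) (hb : ∀ n, 0 < b n)
    (w : ℕ → ℂ) (hw : ∃ C : ℝ, ∀ n, ‖w n‖ ≤ C) (hwb : ∀ n, w n = ((b (n + 1) / b n : ℝ) : ℂ))
    (N : H → ℝ)
    (hN : ∀ h, HasSum (fun n => ((b n)⁻¹ * ‖D ((T.adjoint ^ n) h)‖) ^ 2) (N h))
    {m M : ℝ} (hm : 0 < m) (hM : 0 ≤ M) (hmN : ∀ h, (m * ‖h‖) ^ 2 ≤ N h)
    (hNM : ∀ h, N h ≤ (M * ‖h‖) ^ 2) (p : ℂ[X]) :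
    ‖aeval T p‖ ≤ M / m * ‖aeval (weightedForwardShift w hw) p‖ := by
  obtain ⟨s, e, -⟩ := exists_hilbertBasis ℂ F
  set W := weightedForwardShift w hw
  let x : ℕ → H →L[ℂ] F := fun n => ((b n : ℂ)⁻¹) • D.comp (T.adjoint ^ n)
  have hx : ∀ n h, ‖x n h‖ = (b n)⁻¹ * ‖D ((T.adjoint ^ n) h)‖ := by
    intro n h
    simp [x, norm_smul, abs_of_pos (hb n)]
  have hNx : ∀ h, HasSum (fun n => ‖x n h‖ ^ 2) (N h) := by
    intro h; simpa only [hx] using hN h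
  have hxs : ∀ n h, x n (T.adjoint h) = w n • x (n + 1) h := by
    intro n h
    have h1 : (b n : ℂ) ≠ 0 := by exact_mod_cast (hb n).ne'
    have h2 : (b (n + 1) : ℂ) ≠ 0 := by exact_mod_cast (hb (n + 1)).ne'
    simp only [x, hwb, pow_succ, smul_apply, ContinuousLinearMap.comp_apply,
      mul_apply_eq_comp, smul_smul]
    congr 1
    push_cast
    field_simp
  have hmem : ∀ i h, Memℓp (fun n => ⟪e i, x n h⟫_ℂ) 2 := by
    intro i h
    refine memlp_two_of_norm_le (hNx h).summable fun n => ?_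
    refine (norm_inner_le_norm _ _).trans ?_
    rw [e.orthonormal.1 i, one_mul]
  let L : s → H →ₗ[ℂ] EllTwo := fun i =>
    { toFun := fun h => ⟨fun n => ⟪e i, x n h⟫_ℂ, hmem i h⟩
      map_add' := fun a c => by
        ext n
        exact (congrArg _ (map_add (x n) a c)).trans (inner_add_right _ _ _)
      map_smul' := fun c a => by
        ext n
        exact (congrArg _ (map_smul (x n) c a)).trans (inner_smul_right _ _ _) }
  have hL : ∀ i h n, L i h n = ⟪e i, x n h⟫_ℂ := fun i h n => rfl
  have hLT : ∀ i h, L i (T.adjoint h) = W.adjoint (L i h) := by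
    intro i h
    ext n
    rw [hL, hxs, inner_smul_right, weightedForwardShift_adjoint_apply, hL, hwb, Complex.conj_ofReal]
  have hNL : ∀ h, ENNReal.ofReal (N h) = ∑' i, ENNReal.ofReal (‖L i h‖ ^ 2) := by
    intro h
    have h1 : ∀ i, ENNReal.ofReal (‖L i h‖ ^ 2)
        = ∑' n, ENNReal.ofReal (‖⟪e i, x n h⟫_ℂ‖ ^ 2) := by
      intro i
      have := lp.hasSum_norm_sq (L i h)
      rw [← this.tsum_eq, ENNReal.ofReal_tsum_of_nonneg (fun i => by positivity) this.summable]
      rfl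
    simp_rw [h1]
    rw [ENNReal.tsum_comm]
    simp_rw [HilbertBasis.tsum_ofReal_norm_sq]
    rw [← (hNx h).tsum_eq, ENNReal.ofReal_tsum_of_nonneg (fun i => by positivity) (hNx h).summable]
  -- Conjugated coefficients appear because `p(T)* = q(T*)`.
  set q := p.map (starRingEnd ℂ)
  set c := ‖aeval W p‖
  have hc : ‖aeval W.adjoint q‖ = c := by
    have := star_aeval_eq_aeval_star W p
    rw [ContinuousLinearMap.star_eq_adjoint, ContinuousLinearMap.star_eq_adjoint] at this
    rw [← this, LinearIsometryEquiv.norm_map]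
  have hc' : ‖aeval T.adjoint q‖ = ‖aeval T p‖ := by
    have := star_aeval_eq_aeval_star T p
    rw [ContinuousLinearMap.star_eq_adjoint, ContinuousLinearMap.star_eq_adjoint] at this
    rw [← this, LinearIsometryEquiv.norm_map]
  have hNle : ∀ h, N (aeval T.adjoint q h) ≤ c ^ 2 * N h := by
    intro h
    have hN0 : 0 ≤ N h := (sq_nonneg _).trans (hmN h)
    rw [← ENNReal.ofReal_le_ofReal_iff (by positivity), ENNReal.ofReal_mul (by positivity), hNL, hNL,
      ← ENNReal.tsum_mul_left]
    refine ENNReal.tsum_le_tsum fun i => ?_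
    rw [LinearMap.map_aeval_of_commL (L i) T.adjoint W.adjoint (hLT i),
      ← ENNReal.ofReal_mul (by positivity), ← mul_pow]
    refine ENNReal.ofReal_le_ofReal (pow_le_pow_left₀ (norm_nonneg _) ?_ 2)
    rw [← hc]
    exact ContinuousLinearMap.le_opNorm _ _
  rw [← hc']
  refine ContinuousLinearMap.opNorm_le_bound _ (by positivity) fun h => ?_
  have h1 : (m * ‖aeval T.adjoint q h‖) ^ 2 ≤ (c * (M * ‖h‖)) ^ 2 := by
    refine (hmN _).trans ((hNle h).trans ?_)
    rw [mul_pow c]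
    gcongr
    exact hNM h
  have h2 := (pow_le_pow_iff_left₀ (by positivity) (by positivity) two_ne_zero).1 h1
  rw [div_mul_eq_mul_div, div_mul_eq_mul_div, le_div_iff₀ hm]
  linarith

/-! ### Renewal sequences and Kaluza's lemma -/

/-- The coefficients `c` determined by `a (n + 1) = ∑ m ≤ n, c m * a (n - m)` when `a 0 = 1`. -/
noncomputable def renewalCoeff (a : ℕ → ℝ) : ℕ → ℝ
  | n => a (n + 1) - ∑ m : Fin n, renewalCoeff a m * a (n - m)

lemma renewal_equation {a : ℕ → ℝ} (h0 : a 0 = 1) (n : ℕ) :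
    ∑ m ∈ Finset.range (n + 1), renewalCoeff a m * a (n - m) = a (n + 1) := by
  rw [Finset.sum_range_succ, renewalCoeff,
    ← Fin.sum_univ_eq_sum_range (fun m => renewalCoeff a m * a (n - m))]
  simp [h0]

/-- Kaluza's lemma. -/
lemma renewalCoeff_nonneg {a : ℕ → ℝ} (h0 : a 0 = 1) (hpos : ∀ n, 0 < a n)
    (hconv : ∀ n, a (n + 1) ^ 2 ≤ a n * a (n + 2)) (n : ℕ) : 0 ≤ renewalCoeff a n := by
  have hmono : Monotone fun k => a (k + 1) / a k := by
    refine monotone_nat_of_le_succ fun k => ?_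
    rw [div_le_div_iff₀ (hpos _) (hpos _)]
    nlinarith [hconv k]
  induction n using Nat.strong_induction_on with
  | _ n ih =>
    rw [renewalCoeff, Fin.sum_univ_eq_sum_range (fun m => renewalCoeff a m * a (n - m)), sub_nonneg]
    cases n with
    | zero => simpa using (hpos 1).le
    | succ k =>
      have h1 : a (k + 1 + 1) = a (k + 1 + 1) / a (k + 1) * a (k + 1) := by
        rw [div_mul_cancel₀ _ (hpos _).ne']
      -- Expand this `a (k + 1)` by the renewal equation at `k`. Since the ratios `a (j + 1) / a j`
      -- increase, the last ratio times each term dominates the corresponding term at `k + 1`.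
      rw [h1]
      nth_rewrite 2 [← renewal_equation h0 k]
      rw [Finset.mul_sum]
      refine Finset.sum_le_sum fun m hm => ?_
      have hmk : m ≤ k := Nat.lt_succ_iff.1 (Finset.mem_range.1 hm)
      have h2 : a (k + 1 - m) = a (k - m + 1) / a (k - m) * a (k - m) := by
        rw [div_mul_cancel₀ _ (hpos _).ne', Nat.sub_add_comm hmk]
      have h3 : a (k - m + 1) / a (k - m) ≤ a (k + 1 + 1) / a (k + 1) :=
        hmono (show k - m ≤ k + 1 by omega)
      rw [h2, mul_left_comm]
      exact mul_le_mul_of_nonneg_right h3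
        (mul_nonneg (ih m (Finset.mem_range.1 hm)) (hpos _).le)

lemma renewalCoeff_le {a : ℕ → ℝ} (h0 : a 0 = 1) (hpos : ∀ n, 0 < a n)
    (hconv : ∀ n, a (n + 1) ^ 2 ≤ a n * a (n + 2)) (n : ℕ) : renewalCoeff a n ≤ a (n + 1) := by
  rw [renewalCoeff, sub_le_self_iff]
  exact Finset.sum_nonneg fun m _ =>
    mul_nonneg (renewalCoeff_nonneg h0 hpos hconv m) (hpos _).le

/-- In the double sum of `a n * c m * t (n + m + 1)`, the antidiagonal `n + m = k` contributes `a (k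
+ 1) * t (k + 1)` by the renewal equation. Everything cancels except the term `a 0 * t 0`. -/
lemma hasSum_renewal {a c t : ℕ → ℝ} (h0 : a 0 = 1) (ha : ∀ n, 0 < a n) (hc : ∀ n, 0 ≤ c n)
    (hac : ∀ n, ∑ m ∈ Finset.range (n + 1), c m * a (n - m) = a (n + 1)) (ht : ∀ n, 0 ≤ t n)
    (hs : Summable fun n => a n * t n) :
    HasSum (fun n => a n * (t n - ∑' m, c m * t (n + m + 1))) (t 0) := by
  let f : ℕ × ℕ → ℝ := fun x => a x.1 * (c x.2 * t (x.1 + x.2 + 1))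
  have hf0 : ∀ x, 0 ≤ f x := fun x => mul_nonneg (ha _).le (mul_nonneg (hc _) (ht _))
  have hfib : ∀ n, ∑ x ∈ Finset.HasAntidiagonal.antidiagonal n, f x = a (n + 1) * t (n + 1) := by
    intro n
    rw [← hac n, Finset.sum_mul, ← Finset.Nat.sum_antidiagonal_swap,
      Finset.Nat.sum_antidiagonal_eq_sum_range_succ_mk]
    refine Finset.sum_congr rfl fun m hm => ?_
    have : n - m + m = n := Nat.sub_add_cancel (Nat.lt_succ_iff.1 (Finset.mem_range.1 hm))
    simp only [f, Prod.swap_prod_mk, this]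
    ring
  have hs1 : Summable fun n => a (n + 1) * t (n + 1) := (summable_nat_add_iff 1).2 hs
  have hsig : HasSum (f ∘ Finset.HasAntidiagonal.sigmaAntidiagonalEquivProd) (∑' n, a (n + 1) * t (n + 1)) := by
    have hsum : Summable (f ∘ Finset.HasAntidiagonal.sigmaAntidiagonalEquivProd) := by
      refine (summable_sigma_of_nonneg fun x => hf0 _).2 ⟨fun n => (hasSum_fintype _).summable, ?_⟩
      refine hs1.congr fun n => ?_
      rw [tsum_fintype, ← hfib n, ← Finset.sum_coe_sort]
      rfl
    convert hsum.hasSum using 1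
    rw [hsum.tsum_sigma' fun n => (hasSum_fintype _).summable]
    refine tsum_congr fun n => ?_
    rw [tsum_fintype, ← hfib n, ← Finset.sum_coe_sort]
    rfl
  have hprod : HasSum f (∑' n, a (n + 1) * t (n + 1)) :=
    (Equiv.hasSum_iff Finset.HasAntidiagonal.sigmaAntidiagonalEquivProd).1 hsig
  have hrow := hprod.prod_fiberwise fun n => (hprod.summable.prod_factor n).hasSum
  have h2 := hs.hasSum.sub hrow
  rw [hs.tsum_eq_zero_add, add_sub_cancel_right, h0, one_mul] at h2
  simpa only [f, tsum_mul_left, ← mul_sub] using h2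

/-! ### The defect operator and domination by `extremalShift` -/

lemma exists_sqrt_of_re_inner_nonneg {H : Type*} [NormedAddCommGroup H] [InnerProductSpace ℂ H]
    [CompleteSpace H] (Q : H →L[ℂ] H) (hQ : 0 ≤ Q) :
    ∃ D : H →L[ℂ] H, ∀ h, ‖D h‖ ^ 2 = RCLike.re ⟪Q h, h⟫_ℂ := by
  refine ⟨CFC.sqrt Q, fun h => ?_⟩
  have h1 : IsSelfAdjoint (CFC.sqrt Q) := (CFC.sqrt_nonneg Q).isSelfAdjoint
  have h2 := CFC.sqrt_mul_sqrt_self Q hQ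
  nth_rewrite 2 [← h2]
  rw [mul_apply_eq_comp, ← ContinuousLinearMap.adjoint_inner_right,
    ← ContinuousLinearMap.star_eq_adjoint, h1.star_eq, inner_self_eq_norm_sq]

/-- `D` is the square root of `1 - ∑ c m Tᵐ⁺¹ T*ᵐ⁺¹`, whose positivity follows from `‖T*ᵐ⁺¹ h‖ ≤ K
‖h‖` and `hcK`. -/
lemma exists_defect_operator {H : Type*} [NormedAddCommGroup H] [InnerProductSpace ℂ H]
    [CompleteSpace H] {K : ℝ} (T : H →L[ℂ] H) (hT : ∀ n, ‖T ^ n‖ ≤ K) {c : ℕ → ℝ}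
    (hc : ∀ n, 0 ≤ c n) (hs : Summable c) (hcK : K ^ 2 * ∑' n, c n ≤ 1) :
    ∃ D : H →L[ℂ] H, ∀ h, ‖D h‖ ^ 2 =
      ‖h‖ ^ 2 - ∑' m, c m * ‖(T.adjoint ^ (m + 1)) h‖ ^ 2 := by
  have hTs : ∀ n, ‖T.adjoint ^ n‖ ≤ K := by
    intro n
    rw [← ContinuousLinearMap.star_eq_adjoint, ← star_pow, norm_star]
    exact hT n
  have hK : 0 ≤ K := (norm_nonneg _).trans (hT 0)
  let R : ℕ → H →L[ℂ] H := fun m => (c m : ℂ) • (T ^ (m + 1) * T.adjoint ^ (m + 1))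
  have hR : Summable R := by
    refine Summable.of_norm_bounded (hs.mul_left (K ^ 2)) fun m => ?_
    have := norm_mul_le (T ^ (m + 1)) (T.adjoint ^ (m + 1))
    rw [norm_smul, Complex.norm_real, Real.norm_of_nonneg (hc m), mul_comm]
    refine mul_le_mul_of_nonneg_right (this.trans ?_) (hc m)
    rw [sq]
    exact mul_le_mul (hT _) (hTs _) (norm_nonneg _) hK
  have hRin : ∀ m h, ⟪R m h, h⟫_ℂ = ((c m * ‖(T.adjoint ^ (m + 1)) h‖ ^ 2 : ℝ) : ℂ) := by
    intro m h
    have hadj : (T ^ (m + 1)).adjoint = T.adjoint ^ (m + 1) := by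
      rw [← ContinuousLinearMap.star_eq_adjoint, star_pow, ContinuousLinearMap.star_eq_adjoint]
    simp only [R, smul_apply, mul_apply_eq_comp]
    rw [inner_smul_left, ← ContinuousLinearMap.adjoint_inner_right, hadj, inner_self_eq_norm_sq_to_K]
    simp
  have hQin : ∀ h, ⟪(1 - ∑' m, R m : H →L[ℂ] H) h, h⟫_ℂ =
      ((‖h‖ ^ 2 - ∑' m, c m * ‖(T.adjoint ^ (m + 1)) h‖ ^ 2 : ℝ) : ℂ) := by
    intro h
    have h1 : HasSum (fun m => ⟪R m h, h⟫_ℂ) ⟪(∑' m, R m) h, h⟫_ℂ := by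
      have h2 := (hR.hasSum.mapL (ContinuousLinearMap.apply ℂ H h))
      have h3 := (h2.mapL (innerSL ℂ h)).map (starRingEnd ℂ) Complex.continuous_conj
      simpa [Function.comp_def] using h3
    simp_rw [hRin] at h1
    rw [sub_apply, inner_sub_left, ← h1.tsum_eq, one_apply_eq_self,
      inner_self_eq_norm_sq_to_K]
    push_cast
    rfl
  have hnn : ∀ h, 0 ≤ ‖h‖ ^ 2 - ∑' m, c m * ‖(T.adjoint ^ (m + 1)) h‖ ^ 2 := by
    intro h
    rw [sub_nonneg]
    have hle : ∀ m, c m * ‖(T.adjoint ^ (m + 1)) h‖ ^ 2 ≤ c m * (K * ‖h‖) ^ 2 := by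
      intro m
      refine mul_le_mul_of_nonneg_left ?_ (hc m)
      gcongr
      exact (ContinuousLinearMap.le_opNorm _ _).trans (by gcongr; exact hTs _)
    have hsR := hs.mul_right ((K * ‖h‖) ^ 2)
    have hsL : Summable fun m => c m * ‖(T.adjoint ^ (m + 1)) h‖ ^ 2 :=
      hsR.of_nonneg_of_le (fun m => mul_nonneg (hc m) (by positivity)) hle
    refine (hsL.tsum_le_tsum hle hsR).trans ?_
    rw [tsum_mul_right]
    nlinarith [sq_nonneg ‖h‖]
  obtain ⟨D, hD⟩ := exists_sqrt_of_re_inner_nonneg (1 - ∑' m, R m) (by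
    rw [ContinuousLinearMap.nonneg_iff_isPositive, ContinuousLinearMap.isPositive_iff_complex]
    intro h
    rw [hQin]
    rw [RCLike.re_eq_complex_re, Complex.ofReal_re]
    exact ⟨rfl, hnn h⟩)
  exact ⟨D, fun h => by rw [hD, hQin, RCLike.re_eq_complex_re, Complex.ofReal_re]⟩

theorem norm_aeval_le_extremalShift {H : Type*} [NormedAddCommGroup H] [InnerProductSpace ℂ H]
    [CompleteSpace H] {K : ℝ} (hK : 1 < K) (T : H →L[ℂ] H) (hT : ∀ n, ‖T ^ n‖ ≤ K) (p : ℂ[X]) :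
    ‖aeval T p‖ ≤ ‖aeval (extremalShift K hK) p‖ := by
  have hK0 : 0 < K := by linarith
  -- The slope `2 K` gives `a (n + 1) ≤ 1 / (4 K² (n + 1)²)`, hence `K² ∑ c n ≤ ζ(2) / 4 = π² / 24 <
  -- 1`.
  let b : ℕ → ℝ := fun n => 2 * K * n + 1
  have hb : ∀ n, 0 < b n := fun n => by positivity
  let a : ℕ → ℝ := fun n => ((b n)⁻¹) ^ 2
  have ha0 : a 0 = 1 := by simp [a, b]
  have ha : ∀ n, 0 < a n := fun n => by have := hb n; positivity
  have hconv : ∀ n, a (n + 1) ^ 2 ≤ a n * a (n + 2) := by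
    intro n
    have h1 : b n * b (n + 2) ≤ b (n + 1) ^ 2 := by
      simp only [b]; push_cast; nlinarith
    simp only [a]
    rw [← mul_pow, ← mul_inv, sq ((b (n + 1))⁻¹), ← mul_inv, ← sq]
    have := mul_pos (hb n) (hb (n + 2))
    gcongr
  have hab : ∀ n : ℕ, a (n + 1) ≤ (1 / (4 * K ^ 2)) * (1 / ((n + 1 : ℕ) : ℝ) ^ 2) := by
    intro n
    simp only [a, b]
    rw [div_mul_div_comm, inv_pow, ← one_div, one_mul]
    apply one_div_le_one_div_of_le (by positivity)
    have : 0 < K * ((n + 1 : ℕ) : ℝ) := by positivity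
    nlinarith
  have hz := (hasSum_nat_add_iff' 1).2 hasSum_zeta_two
  simp only [Finset.range_one, Finset.sum_singleton, Nat.cast_zero, ne_eq, OfNat.ofNat_ne_zero,
    not_false_eq_true, zero_pow, div_zero, sub_zero] at hz
  have hz' := hz.mul_left (1 / (4 * K ^ 2))
  have hc0 := renewalCoeff_nonneg ha0 ha hconv
  have hca : ∀ n, renewalCoeff a n ≤ (1 / (4 * K ^ 2)) * (1 / ((n + 1 : ℕ) : ℝ) ^ 2) :=
    fun n => (renewalCoeff_le ha0 ha hconv n).trans (hab n)
  have hcs : Summable (renewalCoeff a) := hz'.summable.of_nonneg_of_le hc0 hca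
  have hcK : K ^ 2 * ∑' n, renewalCoeff a n ≤ 1 := by
    have h1 := hcs.tsum_le_tsum hca hz'.summable
    rw [hz'.tsum_eq] at h1
    have h2 : K ^ 2 * (1 / (4 * K ^ 2) * (Real.pi ^ 2 / 6)) = Real.pi ^ 2 / 24 := by
      field_simp; norm_num
    have h3 := mul_le_mul_of_nonneg_left h1 (sq_nonneg K)
    nlinarith [Real.pi_lt_four, Real.pi_pos]
  have has : Summable a := (summable_nat_add_iff 1).1
    (hz'.summable.of_nonneg_of_le (fun n => (ha _).le) hab)
  obtain ⟨D, hD⟩ := exists_defect_operator T hT hc0 hcs hcK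
  have hTs : ∀ n, ‖T.adjoint ^ n‖ ≤ K := by
    intro n
    rw [← ContinuousLinearMap.star_eq_adjoint, ← star_pow, norm_star]
    exact hT n
  have := norm_aeval_le_of_shift_model T D b hb (fun n => ((shiftAlpha K (n + 1) : ℝ) : ℂ))
    (shiftAlpha_bounded hK) (fun n => by simp [shiftAlpha, b]) (fun h => ‖h‖ ^ 2) (fun h => ?_)
    one_pos zero_le_one (fun h => by simp) (fun h => by simp) p
  · simpa [extremalShift] using this
  · have hs : Summable fun n => a n * ‖(T.adjoint ^ n) h‖ ^ 2 := by
      refine (has.mul_right ((K * ‖h‖) ^ 2)).of_nonneg_of_le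
        (fun n => mul_nonneg (ha n).le (by positivity)) fun n => ?_
      refine mul_le_mul_of_nonneg_left ?_ (ha n).le
      gcongr
      exact (ContinuousLinearMap.le_opNorm _ _).trans (by gcongr; exact hTs _)
    have h1 := hasSum_renewal ha0 ha hc0 (renewal_equation ha0) (fun n => by positivity) hs
    have h2 : ∀ n m, (T.adjoint ^ (m + 1)) ((T.adjoint ^ n) h) = (T.adjoint ^ (n + m + 1)) h := by
      intro n m
      rw [← mul_apply_eq_comp, ← pow_add, add_comm, add_assoc]
    simp only [pow_zero, one_apply_eq_self] at h1
    simpa only [mul_pow, hD, h2] using h1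

end

/-! ### Power bounded weighted shifts against the unilateral shift -/

/-- The unweighted unilateral shift on `ℓ²`. -/
noncomputable def unilateralShift : EllTwo →L[ℂ] EllTwo :=
  weightedForwardShift (fun _ => 1) ⟨1, by simp⟩

lemma hasSum_norm_sq_weightedForwardShift (w : ℕ → ℂ) (hw) (z : EllTwo) :
    HasSum (fun n => ‖w n‖ ^ 2 * ‖z n‖ ^ 2) (‖weightedForwardShift w hw z‖ ^ 2) := by
  have h := (hasSum_nat_add_iff' 1).2 (lp.hasSum_norm_sq (weightedForwardShift w hw z))
  simpa [mul_pow] using h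

/-- Take `d n = sup_j ‖Eʲ eₙ‖`. The term `j = 0` gives `1 ≤ d n`, and `‖w n‖ * d (n + 1)` is the
supremum over `j ≥ 1` only. -/
lemma exists_diagonal_bound {w : ℕ → ℂ} (hw : ∃ C : ℝ, ∀ n, ‖w n‖ ≤ C) {M : ℝ}
    (hM : ∀ n, ‖weightedForwardShift w hw ^ n‖ ≤ M) :
    ∃ d : ℕ → ℝ, (∀ n, 1 ≤ d n) ∧ (∀ n, d n ≤ M) ∧ ∀ n, ‖w n‖ * d (n + 1) ≤ d n := by
  set E := weightedForwardShift w hw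
  have hle : ∀ n j, ‖(E ^ j) (lp.single 2 n (1 : ℂ))‖ ≤ M := by
    intro n j
    refine (ContinuousLinearMap.le_opNorm _ _).trans ?_
    rw [lp.norm_single (by norm_num), norm_one, mul_one]
    exact hM j
  have hbdd : ∀ n, BddAbove (Set.range fun j => ‖(E ^ j) (lp.single 2 n (1 : ℂ))‖) := by
    intro n
    exact ⟨M, by rintro _ ⟨j, rfl⟩; exact hle n j⟩
  refine ⟨fun n => ⨆ j, ‖(E ^ j) (lp.single 2 n (1 : ℂ))‖, fun n => ?_, fun n => ciSup_le (hle n),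
    fun n => ?_⟩
  · refine le_trans ?_ (le_ciSup (hbdd n) 0)
    rw [pow_zero, one_apply_eq_self, lp.norm_single (by norm_num), norm_one]
  · rw [Real.mul_iSup_of_nonneg (norm_nonneg _)]
    refine ciSup_le fun j => ?_
    refine le_trans (le_of_eq ?_) (le_ciSup (hbdd n) (j + 1))
    have h1 : E (lp.single 2 n (1 : ℂ)) = w n • lp.single 2 (n + 1) (1 : ℂ) := by
      rw [weightedForwardShift_single, ← lp.single_smul, smul_eq_mul]
    rw [pow_succ, mul_apply_eq_comp, h1, map_smul, norm_smul]

/-- In the equivalent norm `‖G z‖ ^ 2 = ∑ |z n|² / d n ^ 2` the adjoint of `T = r E` is a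
contraction with defect `D`. The sum of `‖D T*ⁿ z‖ ^ 2` telescopes to `‖G z‖ ^ 2`; the factor `r <
1` sends the remainder to zero. -/
theorem norm_aeval_smul_le_unilateralShift {w : ℕ → ℂ} (hw : ∃ C : ℝ, ∀ n, ‖w n‖ ≤ C) {M : ℝ}
    (hM : ∀ n, ‖weightedForwardShift w hw ^ n‖ ≤ M) {r : ℝ} (hr0 : 0 ≤ r) (hr1 : r < 1) (p : ℂ[X]) :
    ‖aeval ((r : ℂ) • weightedForwardShift w hw) p‖ ≤ M * ‖aeval unilateralShift p‖ := by
  obtain ⟨d, hd1, hdM, hdw⟩ := exists_diagonal_bound hw hM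
  set E := weightedForwardShift w hw
  set T := (r : ℂ) • E with hT
  have hd0 : ∀ n, 0 < d n := fun n => one_pos.trans_le (hd1 n)
  have hM1 : 1 ≤ M := (hd1 0).trans (hdM 0)
  have hM0 : 0 < M := by linarith
  let g : ℕ → ℝ := fun n => (d n ^ 2)⁻¹
  have hg0 : ∀ n, 0 < g n := fun n => by have := hd0 n; positivity
  have hg1 : ∀ n, g n ≤ 1 := fun n => inv_le_one_of_one_le₀ (one_le_pow₀ (hd1 n))
  have hgM : ∀ n, (M⁻¹) ^ 2 ≤ g n := by
    intro n
    have := hd0 n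
    rw [inv_pow]
    simp only [g]
    gcongr
    exact hdM n
  have hgw : ∀ n, r ^ 2 * (‖w n‖ ^ 2 * g n) ≤ g (n + 1) := by
    intro n
    have h1 : ‖w n‖ ^ 2 * g n ≤ g (n + 1) := by
      have h2 : (‖w n‖ * d (n + 1)) ^ 2 ≤ d n ^ 2 := by
        have := hd0 (n + 1)
        gcongr
        exact hdw n
      have := hd0 n
      have := hd0 (n + 1)
      simp only [g]
      rw [← div_eq_mul_inv, ← one_div, div_le_div_iff₀ (by positivity) (by positivity)]
      nlinarith
    have h3 : r ^ 2 ≤ 1 := pow_le_one₀ hr0 hr1.le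
    have h4 : 0 ≤ ‖w n‖ ^ 2 * g n := mul_nonneg (by positivity) (hg0 n).le
    nlinarith
  -- Diagonal entries of the defect; `T*` discards coordinate `0`, so nothing is subtracted there.
  let v : ℕ → ℝ := fun n => Nat.casesOn n (g 0) fun n => g (n + 1) - r ^ 2 * (‖w n‖ ^ 2 * g n)
  have hvz : v 0 = g 0 := rfl
  have hvs : ∀ n, v (n + 1) = g (n + 1) - r ^ 2 * (‖w n‖ ^ 2 * g n) := fun n => rfl
  have hv0 : ∀ n, 0 ≤ v n := by
    rintro (_ | n)
    · exact (hg0 0).le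
    · exact sub_nonneg.2 (hgw n)
  have hv1 : ∀ n, v n ≤ 1 := by
    rintro (_ | n)
    · exact hg1 0
    · refine le_trans (sub_le_self _ ?_) (hg1 (n + 1))
      exact mul_nonneg (sq_nonneg _) (mul_nonneg (by positivity) (hg0 n).le)
  have hsq : ∀ a : ℕ → ℝ, (∀ n, 0 ≤ a n) → ∀ n, ‖((√(a n) : ℝ) : ℂ)‖ ^ 2 = a n := by
    intro a ha n
    rw [Complex.norm_real, Real.norm_of_nonneg (Real.sqrt_nonneg _), Real.sq_sqrt (ha n)]
  have hbd : ∀ a : ℕ → ℝ, (∀ n, a n ≤ 1) → ∃ C : ℝ, ∀ n, ‖((√(a n) : ℝ) : ℂ)‖ ≤ C := by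
    intro a ha
    refine ⟨1, fun n => ?_⟩
    rw [Complex.norm_real, Real.norm_of_nonneg (Real.sqrt_nonneg _)]
    exact Real.sqrt_le_one.2 (ha n)
  -- Only `‖G z‖` and `‖D z‖` matter, so weighted shifts serve in place of diagonal operators.
  let G := weightedForwardShift (fun n => ((√(g n) : ℝ) : ℂ)) (hbd g hg1)
  let D := weightedForwardShift (fun n => ((√(v n) : ℝ) : ℂ)) (hbd v hv1)
  have hG : ∀ z, HasSum (fun n => g n * ‖z n‖ ^ 2) (‖G z‖ ^ 2) := by
    intro z
    simpa only [hsq g fun n => (hg0 n).le] using hasSum_norm_sq_weightedForwardShift _ (hbd g hg1) z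
  have hD : ∀ z, HasSum (fun n => v n * ‖z n‖ ^ 2) (‖D z‖ ^ 2) := by
    intro z
    simpa only [hsq v hv0] using hasSum_norm_sq_weightedForwardShift _ (hbd v hv1) z
  have hTadj : T.adjoint = (r : ℂ) • E.adjoint := by
    rw [hT, map_smulₛₗ, Complex.conj_ofReal]
  have hDG : ∀ z, ‖D z‖ ^ 2 = ‖G z‖ ^ 2 - ‖G (T.adjoint z)‖ ^ 2 := by
    intro z
    have h1 := (hasSum_nat_add_iff' 1).2 ((hG z).sub (hD z))
    simp only [Finset.range_one, Finset.sum_singleton, hvz, hvs, sub_self, sub_zero] at h1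
    have h2 := hG (T.adjoint z)
    have h3 : ∀ n, g n * ‖T.adjoint z n‖ ^ 2 = g (n + 1) * ‖z (n + 1)‖ ^ 2 -
        (g (n + 1) - r ^ 2 * (‖w n‖ ^ 2 * g n)) * ‖z (n + 1)‖ ^ 2 := by
      intro n
      have h4 : T.adjoint z n = r * (starRingEnd ℂ (w n) * z (n + 1)) := by
        rw [hTadj, ← weightedForwardShift_adjoint_apply w hw]
        rfl
      rw [h4, norm_mul, norm_mul, Complex.norm_real, RCLike.norm_conj, Real.norm_of_nonneg hr0]
      ring
    simp_rw [h3] at h2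
    have := h1.unique h2
    linarith
  have hG1 : ∀ z, ‖G z‖ ^ 2 ≤ (1 * ‖z‖) ^ 2 := by
    intro z
    rw [one_mul]
    refine hasSum_le (fun n => ?_) (hG z) (lp.hasSum_norm_sq z)
    exact mul_le_of_le_one_left (by positivity) (hg1 n)
  have hGM : ∀ z, (M⁻¹ * ‖z‖) ^ 2 ≤ ‖G z‖ ^ 2 := by
    intro z
    rw [mul_pow]
    refine hasSum_le (fun n => ?_) ((lp.hasSum_norm_sq z).mul_left _) (hG z)
    exact mul_le_mul_of_nonneg_right (hgM n) (by positivity)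
  have hTn : ∀ n, ‖T.adjoint ^ n‖ ≤ r ^ n * M := by
    intro n
    rw [hTadj, _root_.smul_pow, norm_smul, norm_pow, Complex.norm_real, Real.norm_of_nonneg hr0,
      ← ContinuousLinearMap.star_eq_adjoint, ← star_pow, norm_star]
    exact mul_le_mul_of_nonneg_left (hM n) (by positivity)
  have hlim : ∀ z, Filter.Tendsto (fun n => ‖G ((T.adjoint ^ n) z)‖ ^ 2) Filter.atTop (nhds 0) := by
    intro z
    have h1 : Filter.Tendsto (fun n : ℕ => (1 * (r ^ n * M * ‖z‖)) ^ 2) Filter.atTop (nhds 0) := by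
      have := ((((tendsto_pow_atTop_nhds_zero_of_lt_one hr0 hr1).mul_const M).mul_const
        ‖z‖).const_mul 1).pow 2
      simpa using this
    refine squeeze_zero (fun n => by positivity) (fun n => (hG1 _).trans ?_) h1
    gcongr
    exact (ContinuousLinearMap.le_opNorm _ _).trans (by gcongr; exact hTn n)
  have := norm_aeval_le_of_shift_model T D (fun _ => 1) (fun _ => one_pos) (fun _ => 1) ⟨1, by simp⟩
    (by simp) (fun z => ‖G z‖ ^ 2) (fun z => ?_) (inv_pos.2 hM0) zero_le_one hGM hG1 p
  · simpa [unilateralShift] using this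
  · simp only [inv_one, one_mul]
    rw [hasSum_iff_tendsto_nat_of_nonneg fun n => by positivity]
    have h1 : ∀ n, ‖D ((T.adjoint ^ n) z)‖ ^ 2 =
        ‖G ((T.adjoint ^ n) z)‖ ^ 2 - ‖G ((T.adjoint ^ (n + 1)) z)‖ ^ 2 := by
      intro n
      rw [hDG, pow_succ' T.adjoint, mul_apply_eq_comp]
    simp_rw [h1, Finset.sum_range_sub' fun n => ‖G ((T.adjoint ^ n) z)‖ ^ 2]
    simpa using (hlim z).const_sub (‖G z‖ ^ 2)

/-! ### The shift as multiplication by the variable on Hardy space -/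

/-- The coefficient sequence of a polynomial as a vector of `ℓ²`. -/
noncomputable def polyToEllTwo : ℂ[X] →ₗ[ℂ] EllTwo where
  toFun q := ⟨fun n => q.coeff n, by
    refine (memℓp_gen_iff (by norm_num)).2 ?_
    refine summable_of_hasFiniteSupport (q.support.finite_toSet.subset fun n hn => ?_)
    by_contra h
    exact hn (by simp [Polynomial.notMem_support_iff.1 h])⟩
  map_add' p q := by ext n; exact coeff_add p q n
  map_smul' c q := by ext n; exact coeff_smul c q n

@[simp] lemma polyToEllTwo_apply (q : ℂ[X]) (n : ℕ) : polyToEllTwo q n = q.coeff n := rfl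

lemma norm_sq_polyToEllTwo (q : ℂ[X]) :
    ‖polyToEllTwo q‖ ^ 2 = Real.circleAverage (fun z => ‖q.eval z‖ ^ 2) 0 1 := by
  rw [← sum_sq_norm_coeff_eq_circleAverage, lp.norm_sq_eq_tsum]
  refine tsum_eq_sum fun n hn => ?_
  simp [Polynomial.notMem_support_iff.1 hn]

lemma aeval_unilateralShift_polyToEllTwo (p q : ℂ[X]) :
    aeval unilateralShift p (polyToEllTwo q) = polyToEllTwo (p * q) := by
  rw [ContinuousLinearMap.coe_aeval_apply,
    ← LinearMap.map_aeval_of_comm polyToEllTwo (Algebra.lmul ℂ ℂ[X] X), aeval_algHom_apply,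
    aeval_X_left_apply]
  · rfl
  · intro q
    ext n
    cases n with
    | zero => simp [unilateralShift]
    | succ n => simp [unilateralShift]

lemma denseRange_polyToEllTwo : DenseRange polyToEllTwo := by
  intro z
  refine mem_closure_of_tendsto (lp.hasSum_single (by norm_num) z) (Filter.Eventually.of_forall
    fun s => ⟨∑ n ∈ s, monomial n (z n), ?_⟩)
  rw [map_sum]
  refine Finset.sum_congr rfl fun n _ => ?_
  ext k
  simp [coeff_monomial, lp.single_apply, Pi.single_apply, eq_comm]

/-- On the dense subspace of polynomials `p(S)` is multiplication by `p`, and Parseval turns the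
claim into a pointwise bound on the circle. -/
theorem norm_aeval_unilateralShift_le {p : ℂ[X]} {B : ℝ}
    (hB : ∀ z : ℂ, ‖z‖ = 1 → ‖p.eval z‖ ≤ B) : ‖aeval unilateralShift p‖ ≤ B := by
  have hB0 : 0 ≤ B := (norm_nonneg _).trans (hB 1 norm_one)
  refine ContinuousLinearMap.opNorm_le_bound _ hB0 fun z => ?_
  refine denseRange_polyToEllTwo.induction_on z
    (isClosed_le (by fun_prop) (by fun_prop)) fun q => ?_
  rw [aeval_unilateralShift_polyToEllTwo]
  refine (pow_le_pow_iff_left₀ (norm_nonneg _) (by positivity) two_ne_zero).1 ?_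
  rw [mul_pow, norm_sq_polyToEllTwo, norm_sq_polyToEllTwo, ← smul_eq_mul (B ^ 2),
    ← Real.circleAverage_fun_smul]
  refine Real.circleAverage_mono ?_ ?_ fun z hz => ?_
  · exact ContinuousOn.circleIntegrable' (by fun_prop)
  · exact ContinuousOn.circleIntegrable' (by fun_prop)
  · have hz1 : ‖z‖ = 1 := by simpa using hz
    rw [eval_mul, norm_mul, mul_pow, smul_eq_mul]
    gcongr
    exact hB z hz1

/-! ### Rudin–Shapiro type polynomials -/

/-- A Rudin–Shapiro type pair of polynomials whose first member has coefficient `ε` at the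
first powers of `4`. -/
noncomputable def lacunaryPair (ε : ℝ) : ℕ → ℂ[X] × ℂ[X]
  | 0 => (0, 1)
  | k + 1 => ((lacunaryPair ε k).1 + C (ε : ℂ) * reflect (4 ^ k) (lacunaryPair ε k).2,
      (lacunaryPair ε k).2 - C (ε : ℂ) * reflect (4 ^ k) (lacunaryPair ε k).1)

lemma coeff_reflect_of_lt {N i : ℕ} (h : N < i) (f : ℂ[X]) : (reflect N f).coeff i = f.coeff i := by
  rw [coeff_reflect, revAt_eq_self_of_lt h]

lemma lacunaryPair_coeff_eq_zero (ε : ℝ) (k : ℕ) :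
    (∀ i, 4 ^ k ≤ i → (lacunaryPair ε k).1.coeff i = 0) ∧
      ∀ i, 4 ^ k < 4 * i → (lacunaryPair ε k).2.coeff i = 0 := by
  induction k with
  | zero =>
    refine ⟨by simp [lacunaryPair], fun i hi => ?_⟩
    have : i ≠ 0 := by omega
    simp [lacunaryPair, coeff_one, this]
  | succ k ih =>
    have h4 : 0 < 4 ^ k := by positivity
    refine ⟨fun i hi => ?_, fun i hi => ?_⟩
    · have h1 : 4 ^ k < i := by omega
      simp only [lacunaryPair, coeff_add, coeff_C_mul, coeff_reflect_of_lt h1, ih.1 i h1.le,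
        ih.2 i (by omega), mul_zero, add_zero]
    · have h1 : 4 ^ k < i := by omega
      simp only [lacunaryPair, coeff_sub, coeff_C_mul, coeff_reflect_of_lt h1, ih.1 i h1.le,
        ih.2 i (by omega), mul_zero, sub_zero]

/-- Reflection at `4 ^ k` carries the constant term `1` to index `4 ^ k`. The second member has
degree at most `4 ^ k / 4`, so its reflection misses the earlier powers of `4`. -/
lemma lacunaryPair_coeff_pow (ε : ℝ) (k : ℕ) :
    (lacunaryPair ε k).2.coeff 0 = 1 ∧ ∀ j < k, (lacunaryPair ε k).1.coeff (4 ^ j) = ε := by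
  induction k with
  | zero => simp [lacunaryPair]
  | succ k ih =>
    obtain ⟨h1, h2⟩ := lacunaryPair_coeff_eq_zero ε k
    refine ⟨?_, fun j hj => ?_⟩
    · simp only [lacunaryPair, coeff_sub, coeff_C_mul, coeff_reflect, revAt_le (Nat.zero_le _),
        Nat.sub_zero, h1 _ le_rfl, mul_zero, sub_zero, ih.1]
    · have hle : 4 ^ j ≤ 4 ^ k := Nat.pow_le_pow_right (by norm_num) (Nat.lt_succ_iff.1 hj)
      simp only [lacunaryPair, coeff_add, coeff_C_mul, coeff_reflect, revAt_le hle]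
      rcases (Nat.lt_succ_iff.1 hj).eq_or_lt with rfl | hlt
      · simp [h1 _ le_rfl, ih.1]
      · have h3 : 4 ^ (j + 1) ≤ 4 ^ k := Nat.pow_le_pow_right (by norm_num) hlt
        have h4 : 0 < 4 ^ j := by positivity
        rw [ih.2 j hlt, h2 _ (by omega), mul_zero, add_zero]

lemma eval_reflect_of_norm_eq_one {f : ℂ[X]} {N : ℕ} (hf : f.natDegree ≤ N) {z : ℂ}
    (hz : ‖z‖ = 1) : (reflect N f).eval z = z ^ N * f.eval (starRingEnd ℂ z) := by
  have hz0 : starRingEnd ℂ z ≠ 0 := by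
    rw [← norm_ne_zero_iff, RCLike.norm_conj, hz]; exact one_ne_zero
  have hzz : z * starRingEnd ℂ z = 1 := by
    rw [Complex.mul_conj, Complex.normSq_eq_norm_sq, hz]; norm_num
  let _ : Invertible (starRingEnd ℂ z) := ⟨z, hzz, by rw [mul_comm, hzz]⟩
  have h := eval₂_reflect_mul_pow (RingHom.id ℂ) (starRingEnd ℂ z) N f hf
  have hinv : ⅟(starRingEnd ℂ z) = z := rfl
  rw [hinv, ← eval, ← eval] at h
  rw [← h, mul_left_comm, ← mul_pow, hzz, one_pow, mul_one]

lemma norm_sq_add_norm_sq_rotate (ε : ℝ) {u : ℂ} (hu : ‖u‖ = 1) (a b : ℂ) :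
    ‖a + ε * (u * b)‖ ^ 2 + ‖b - ε * (starRingEnd ℂ u * a)‖ ^ 2 =
      (1 + ε ^ 2) * (‖a‖ ^ 2 + ‖b‖ ^ 2) := by
  have huu : u * starRingEnd ℂ u = 1 := by
    rw [Complex.mul_conj, Complex.normSq_eq_norm_sq, hu]; norm_num
  have key : ∀ x : ℂ, ((‖x‖ ^ 2 : ℝ) : ℂ) = x * starRingEnd ℂ x := by
    intro x; rw [Complex.mul_conj, Complex.normSq_eq_norm_sq]
  apply Complex.ofReal_injective
  rw [Complex.ofReal_add, Complex.ofReal_mul, Complex.ofReal_add (‖a‖ ^ 2), key, key, key, key]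
  simp only [map_add, map_sub, map_mul, Complex.conj_ofReal, Complex.conj_conj]
  push_cast
  linear_combination (ε ^ 2 * (b * starRingEnd ℂ b + a * starRingEnd ℂ a)) * huu

/-- For `|z| = 1`, each step acts on the pair of values at `z` and `conj z` as `√(1 + ε²)` times a
unitary matrix. -/
lemma norm_eval_lacunaryPair (ε : ℝ) (k : ℕ) {z : ℂ} (hz : ‖z‖ = 1) :
    ‖(lacunaryPair ε k).1.eval z‖ ^ 2 + ‖(lacunaryPair ε k).2.eval (starRingEnd ℂ z)‖ ^ 2 =
      (1 + ε ^ 2) ^ k := by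
  induction k with
  | zero => simp [lacunaryPair]
  | succ k ih =>
    obtain ⟨h1, h2⟩ := lacunaryPair_coeff_eq_zero ε k
    have hd1 : (lacunaryPair ε k).1.natDegree ≤ 4 ^ k :=
      natDegree_le_iff_coeff_eq_zero.2 fun i hi => h1 i hi.le
    have hd2 : (lacunaryPair ε k).2.natDegree ≤ 4 ^ k :=
      natDegree_le_iff_coeff_eq_zero.2 fun i hi => h2 i (by omega)
    have hz' : ‖starRingEnd ℂ z‖ = 1 := by rwa [RCLike.norm_conj]
    have hu : ‖z ^ 4 ^ k‖ = 1 := by rw [norm_pow, hz, one_pow]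
    have := norm_sq_add_norm_sq_rotate ε hu ((lacunaryPair ε k).1.eval z)
      ((lacunaryPair ε k).2.eval (starRingEnd ℂ z))
    rw [ih, map_pow] at this
    rw [pow_succ' (1 + ε ^ 2), ← this]
    simp only [lacunaryPair, eval_add, eval_sub, eval_mul, eval_C,
      eval_reflect_of_norm_eq_one hd2 hz, eval_reflect_of_norm_eq_one hd1 hz', Complex.conj_conj]

/-- There are polynomials bounded on the unit circle whose coefficients at the powers of `4` have
arbitrarily large sum. -/
theorem exists_bounded_polynomial_large_coeff_sum (m : ℕ) (hm : 0 < m) :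
    ∃ p : ℂ[X], ‖aeval unilateralShift p‖ ≤ 2 ∧
      ∀ k < m, p.coeff (4 ^ k) = ((√m)⁻¹ : ℝ) := by
  refine ⟨(lacunaryPair (√m)⁻¹ m).1, norm_aeval_unilateralShift_le fun z hz => ?_,
    (lacunaryPair_coeff_pow _ m).2⟩
  have h1 := norm_eval_lacunaryPair (√m)⁻¹ m hz
  have hm' : (0 : ℝ) < m := by exact_mod_cast hm
  -- The squared modulus is at most `(1 + 1/m)ᵐ ≤ e < 4`.
  have h2 : (1 + ((√m)⁻¹) ^ 2) ^ m ≤ Real.exp 1 := by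
    rw [inv_pow, Real.sq_sqrt hm'.le]
    calc (1 + (m : ℝ)⁻¹) ^ m ≤ (Real.exp ((m : ℝ)⁻¹)) ^ m := by
          gcongr
          rw [add_comm]
          exact Real.add_one_le_exp _
      _ = Real.exp 1 := by
          rw [← Real.exp_nat_mul, mul_inv_cancel₀ hm'.ne']
  have h3 := Real.exp_one_lt_d9
  refine (pow_le_pow_iff_left₀ (norm_nonneg _) zero_le_two two_ne_zero).1 ?_
  nlinarith [sq_nonneg ‖(lacunaryPair (√m)⁻¹ m).2.eval (starRingEnd ℂ z)‖]

/-! ### A lacunary Hankel operator -/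

lemma memℓp_flip (n : ℕ) (z : EllTwo) :
    Memℓp (fun i => if i ≤ n then z (n - i) else 0) 2 := by
  refine (memℓp_gen_iff (by norm_num)).2 ?_
  refine summable_of_hasFiniteSupport ((Set.finite_Iic n).subset fun i hi => ?_)
  by_contra h
  exact hi (by simp [Set.mem_Iic.not.1 h])

/-- The Hankel operator `e i ↦ e (n - i)` for `i ≤ n`, vanishing on the other basis vectors. -/
noncomputable def flipOp (n : ℕ) : EllTwo →L[ℂ] EllTwo :=
  LinearMap.mkContinuous
    { toFun := fun z => ⟨fun i => if i ≤ n then z (n - i) else 0, memℓp_flip n z⟩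
      map_add' := fun x y => by
        ext i
        change (if i ≤ n then x (n - i) + y (n - i) else 0) =
          (if i ≤ n then x (n - i) else 0) + if i ≤ n then y (n - i) else 0
        split_ifs <;> simp
      map_smul' := fun c x => by
        ext i
        change (if i ≤ n then c * x (n - i) else 0) = c * if i ≤ n then x (n - i) else 0
        split_ifs <;> simp } 1 fun z => by
    rw [one_mul]
    refine (pow_le_pow_iff_left₀ (norm_nonneg _) (norm_nonneg _) two_ne_zero).1 ?_
    rw [lp.norm_sq_eq_tsum, tsum_eq_sum (s := Finset.range (n + 1))]
    · refine le_trans (le_of_eq ?_)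
        (sum_le_hasSum (Finset.range (n + 1)) (fun i _ => by positivity) (lp.hasSum_norm_sq z))
      rw [← Finset.sum_range_reflect]
      refine Finset.sum_congr rfl fun i hi => ?_
      have hi' : i ≤ n := Nat.lt_succ_iff.1 (Finset.mem_range.1 hi)
      change ‖if n + 1 - 1 - i ≤ n then z (n - (n + 1 - 1 - i)) else 0‖ ^ 2 = _
      rw [if_pos (by omega), show n - (n + 1 - 1 - i) = i by omega]
    · intro i hi
      have hi' : ¬ i ≤ n := fun h => hi (Finset.mem_range.2 (Nat.lt_succ_iff.2 h))
      change ‖if i ≤ n then z (n - i) else 0‖ ^ 2 = 0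
      rw [if_neg hi']
      simp

lemma flipOp_apply (n : ℕ) (z : EllTwo) (i : ℕ) :
    flipOp n z i = if i ≤ n then z (n - i) else 0 := rfl

lemma norm_flipOp_le (n : ℕ) (z : EllTwo) : ‖flipOp n z‖ ≤ ‖z‖ := by
  have h : ‖flipOp n‖ ≤ 1 := LinearMap.mkContinuous_norm_le _ zero_le_one _
  simpa using ContinuousLinearMap.le_of_opNorm_le _ h z

lemma unilateralShift_apply_zero (z : EllTwo) : unilateralShift z 0 = 0 := rfl

lemma unilateralShift_apply_succ (z : EllTwo) (n : ℕ) : unilateralShift z (n + 1) = z n := by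
  simp [unilateralShift]

lemma unilateralShift_adjoint_apply (z : EllTwo) (n : ℕ) :
    unilateralShift.adjoint z n = z (n + 1) := by
  simp [unilateralShift]

lemma unilateralShift_pow_apply (z : EllTwo) (n i : ℕ) :
    (unilateralShift ^ n) z i = if n ≤ i then z (i - n) else 0 := by
  induction n generalizing i with
  | zero => simp
  | succ n ih =>
    rw [pow_succ', mul_apply_eq_comp]
    cases i with
    | zero => simp [unilateralShift_apply_zero]
    | succ i => simp only [unilateralShift_apply_succ, ih, Nat.add_le_add_iff_right,
        Nat.add_sub_add_right]

lemma norm_unilateralShift_le : ‖unilateralShift‖ ≤ 1 := by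
  simpa using norm_aeval_unilateralShift_le (p := X) (B := 1) fun z hz => by simp [hz]

lemma ContinuousLinearMap.norm_pow_apply_le_of_contraction {H : Type*} [NormedAddCommGroup H]
    [NormedSpace ℂ H] {T : H →L[ℂ] H} (hT : ‖T‖ ≤ 1) (n : ℕ) (x : H) : ‖(T ^ n) x‖ ≤ ‖x‖ := by
  induction n with
  | zero => simp
  | succ n ih =>
    rw [pow_succ', mul_apply_eq_comp]
    refine (T.le_of_opNorm_le hT _).trans ?_
    rwa [one_mul]

lemma unilateralShift_adjoint_flipOp (n : ℕ) (z : EllTwo) :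
    unilateralShift.adjoint (flipOp n z) = flipOp n (unilateralShift z) := by
  ext i
  rw [unilateralShift_adjoint_apply, flipOp_apply, flipOp_apply]
  rcases lt_trichotomy i n with h | rfl | h
  · obtain ⟨j, rfl⟩ := Nat.exists_eq_add_of_lt h
    rw [if_pos (by omega), if_pos (by omega), show i + j + 1 - i = j + 1 by omega,
      unilateralShift_apply_succ, show i + j + 1 - (i + 1) = j by omega]
  · simp [unilateralShift_apply_zero]
  · rw [if_neg (by omega), if_neg (by omega)]

lemma flipOp_unilateralShift_pow (n j : ℕ) (z : EllTwo) :
    flipOp n ((unilateralShift ^ j) z) = if j ≤ n then flipOp (n - j) z else 0 := by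
  ext i
  rw [flipOp_apply, unilateralShift_pow_apply]
  by_cases hj : j ≤ n
  · rw [if_pos hj, flipOp_apply]
    by_cases h : i ≤ n - j
    · rw [if_pos (by omega), if_pos (by omega), if_pos h, show n - i - j = n - j - i by omega]
    · rw [if_neg h]
      split_ifs
      · omega
      · rfl
      · rfl
  · rw [if_neg hj]
    split_ifs
    · omega
    · rfl
    · rfl

/-- A Hankel operator with lacunary symbol. -/
noncomputable def lacunaryHankel (m : ℕ) : EllTwo →L[ℂ] EllTwo :=
  ∑ k ∈ Finset.range m, (((4 : ℝ) ^ k)⁻¹ : ℂ) • flipOp (4 ^ k - 1)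

lemma lacunaryHankel_apply (m : ℕ) (z : EllTwo) :
    lacunaryHankel m z = ∑ k ∈ Finset.range m, (((4 : ℝ) ^ k)⁻¹ : ℂ) • flipOp (4 ^ k - 1) z := by
  simp [lacunaryHankel]

lemma unilateralShift_adjoint_lacunaryHankel (m : ℕ) (z : EllTwo) :
    unilateralShift.adjoint (lacunaryHankel m z) = lacunaryHankel m (unilateralShift z) := by
  simp [lacunaryHankel_apply, unilateralShift_adjoint_flipOp]

lemma sum_lacunary_tail_le (N : ℝ) (hN : 0 ≤ N) (m : ℕ) :
    ∑ k ∈ Finset.range m, (if N ≤ 4 ^ k then N / 4 ^ k else 0) ≤ 4 / 3 := by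
  -- For the induction, the second clause also carries the whole geometric tail `∑_{k ≥ m} N / 4 ^ k
  -- = 4/3 * (N / 4 ^ m)`.
  have key : (4 ^ m < N → ∑ k ∈ Finset.range m, (if N ≤ 4 ^ k then N / 4 ^ k else 0) = 0) ∧
      (N ≤ 4 ^ m → ∑ k ∈ Finset.range m, (if N ≤ 4 ^ k then N / 4 ^ k else 0)
        + 4 / 3 * (N / 4 ^ m) ≤ 4 / 3) := by
    induction m with
    | zero => simp
    | succ m ih =>
      have h4 : (0 : ℝ) < 4 ^ m := by positivity
      rw [Finset.sum_range_succ, pow_succ]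
      refine ⟨fun h => ?_, fun h => ?_⟩
      · rw [ih.1 (by linarith), if_neg (by linarith), add_zero]
      · rw [← div_div]
        rcases le_or_gt N (4 ^ m) with h' | h'
        · rw [if_pos h']
          linarith [ih.2 h']
        · rw [ih.1 h', if_neg h'.not_ge]
          have : N / 4 ^ m ≤ 4 := by rw [div_le_iff₀ h4]; linarith
          linarith
  rcases le_or_gt N (4 ^ m) with h | h
  · have : 0 ≤ N / 4 ^ m := by positivity
    linarith [key.2 h]
  · rw [key.1 h]
    norm_num

/-- `Sⁿ` kills the blocks with `4 ^ k ≤ n`; the surviving coefficients `4⁻ᵏ` sum to at most `4/3 /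
(n + 1)`. This decay offsets the factor `n + 1` in powers of the Foguel–Hankel operator. -/
lemma norm_lacunaryHankel_pow_le (m n : ℕ) (z : EllTwo) :
    (n + 1) * ‖lacunaryHankel m ((unilateralShift ^ n) z)‖ ≤ 4 / 3 * ‖z‖ := by
  rw [lacunaryHankel_apply]
  refine le_trans ?_ (mul_le_mul_of_nonneg_right
    (sum_lacunary_tail_le (n + 1) (by positivity) m) (norm_nonneg z))
  rw [Finset.sum_mul]
  refine (mul_le_mul_of_nonneg_left (norm_sum_le _ _) (by positivity)).trans ?_
  rw [Finset.mul_sum]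
  refine Finset.sum_le_sum fun k _ => ?_
  have h4 : 0 < 4 ^ k := by positivity
  rw [flipOp_unilateralShift_pow, norm_smul]
  have hn : ‖(((4 : ℝ) ^ k)⁻¹ : ℂ)‖ = ((4 : ℝ) ^ k)⁻¹ := by simp
  rw [hn]
  by_cases h : n ≤ 4 ^ k - 1
  · have h' : ((n : ℝ) + 1) ≤ 4 ^ k := by exact_mod_cast (show n + 1 ≤ 4 ^ k by omega)
    rw [if_pos h, if_pos h', div_eq_mul_inv, mul_assoc]
    gcongr
    exact norm_flipOp_le _ _
  · have h' : ¬ ((n : ℝ) + 1) ≤ 4 ^ k := by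
      intro h'
      have : n + 1 ≤ 4 ^ k := by exact_mod_cast h'
      omega
    rw [if_neg h, if_neg h']
    simp

/-! ### Foguel–Hankel operators -/

/-- The Foguel–Hankel operator `[[S*, δ Γ], [0, S]]` with a lacunary Hankel operator `Γ`. -/
noncomputable def foguelHankel (δ : ℝ) (m : ℕ) :
    WithLp 2 (EllTwo × EllTwo) →L[ℂ] WithLp 2 (EllTwo × EllTwo) :=
  let e := WithLp.prodContinuousLinearEquiv 2 ℂ EllTwo EllTwo
  (e.symm : EllTwo × EllTwo →L[ℂ] WithLp 2 (EllTwo × EllTwo)) ∘L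
    ((unilateralShift.adjoint ∘L ContinuousLinearMap.fst ℂ EllTwo EllTwo +
        (δ : ℂ) • lacunaryHankel m ∘L ContinuousLinearMap.snd ℂ EllTwo EllTwo).prod
      (unilateralShift ∘L ContinuousLinearMap.snd ℂ EllTwo EllTwo)) ∘L
    (e : WithLp 2 (EllTwo × EllTwo) →L[ℂ] EllTwo × EllTwo)

lemma foguelHankel_apply (δ : ℝ) (m : ℕ) (z : WithLp 2 (EllTwo × EllTwo)) :
    foguelHankel δ m z = WithLp.toLp 2
      (unilateralShift.adjoint z.fst + (δ : ℂ) • lacunaryHankel m z.snd, unilateralShift z.snd) :=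
  rfl

/-- By the Hankel relation `S* Γ = Γ S`, all `n + 1` terms of the corner coincide. -/
lemma foguelHankel_pow_succ_apply (δ : ℝ) (m n : ℕ) (z : WithLp 2 (EllTwo × EllTwo)) :
    (foguelHankel δ m ^ (n + 1)) z = WithLp.toLp 2
      ((unilateralShift.adjoint ^ (n + 1)) z.fst +
        ((n + 1 : ℝ) : ℂ) • (δ : ℂ) • lacunaryHankel m ((unilateralShift ^ n) z.snd),
        (unilateralShift ^ (n + 1)) z.snd) := by
  induction n with
  | zero => simp [foguelHankel_apply]
  | succ n ih =>
    rw [pow_succ' (foguelHankel δ m), mul_apply_eq_comp, ih, foguelHankel_apply]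
    simp only [WithLp.toLp_fst, WithLp.toLp_snd, map_add, map_smul,
      unilateralShift_adjoint_lacunaryHankel]
    rw [← mul_apply_eq_comp unilateralShift.adjoint, ← mul_apply_eq_comp unilateralShift,
      ← mul_apply_eq_comp unilateralShift, ← pow_succ' unilateralShift.adjoint,
      ← pow_succ' unilateralShift, ← pow_succ' unilateralShift, add_assoc]
    congr 3
    push_cast
    module

lemma norm_foguelHankel_pow_le {δ : ℝ} (hδ : 0 ≤ δ) (m n : ℕ) :
    ‖foguelHankel δ m ^ n‖ ≤ 1 + δ * (4 / 3) := by
  cases n with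
  | zero =>
    rw [pow_zero]
    refine ContinuousLinearMap.norm_id_le.trans ?_
    linarith
  | succ n =>
    refine ContinuousLinearMap.opNorm_le_bound _ (by positivity) fun z => ?_
    have hS' : ‖unilateralShift.adjoint‖ ≤ 1 := by
      rw [LinearIsometryEquiv.norm_map]
      exact norm_unilateralShift_le
    have hdecomp : (foguelHankel δ m ^ (n + 1)) z =
        WithLp.toLp 2 ((unilateralShift.adjoint ^ (n + 1)) z.fst, (unilateralShift ^ (n + 1)) z.snd) +
        WithLp.toLp 2 (((n + 1 : ℝ) : ℂ) • (δ : ℂ) • lacunaryHankel m ((unilateralShift ^ n) z.snd),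
          (0 : EllTwo)) := by
      rw [foguelHankel_pow_succ_apply, ← WithLp.toLp_add, Prod.mk_add_mk, add_zero]
    rw [hdecomp, add_mul, one_mul]
    refine (norm_add_le _ _).trans (add_le_add ?_ ?_)
    · refine (pow_le_pow_iff_left₀ (norm_nonneg _) (norm_nonneg _) two_ne_zero).1 ?_
      rw [WithLp.prod_norm_sq_eq_of_L2, WithLp.prod_norm_sq_eq_of_L2]
      gcongr
      · exact ContinuousLinearMap.norm_pow_apply_le_of_contraction hS' _ _
      · exact ContinuousLinearMap.norm_pow_apply_le_of_contraction norm_unilateralShift_le _ _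
    · rw [WithLp.norm_toLp_fst, norm_smul, norm_smul, Complex.norm_real, Complex.norm_real,
        Real.norm_of_nonneg hδ, Real.norm_of_nonneg (by positivity), mul_left_comm, mul_assoc δ]
      refine mul_le_mul_of_nonneg_left ?_ hδ
      exact (norm_lacunaryHankel_pow_le m n z.snd).trans
        (mul_le_mul_of_nonneg_left (WithLp.norm_snd_le _ z) (by norm_num))

/-- The weight `4⁻ᵏ` cancels the multiplicity `n = 4 ^ k`, so every power of `4` contributes exactly
`δ`. -/
lemma foguelHankel_pow_corner (δ : ℝ) (m n : ℕ) :
    ((foguelHankel δ m ^ n) (WithLp.toLp 2 ((0 : EllTwo), lp.single 2 0 (1 : ℂ)))).fst 0 =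
      δ * ∑ k ∈ Finset.range m, if n = 4 ^ k then 1 else 0 := by
  cases n with
  | zero => simp [show ∀ k : ℕ, ¬ 0 = 4 ^ k from fun k => (by positivity : 0 < 4 ^ k).ne]
  | succ n =>
    rw [foguelHankel_pow_succ_apply, lacunaryHankel_apply, Finset.smul_sum, Finset.smul_sum]
    simp only [WithLp.toLp_fst, WithLp.toLp_snd, map_zero, zero_add, Finset.mul_sum]
    rw [lp.coeFn_sum, Finset.sum_apply]
    refine Finset.sum_congr rfl fun k _ => ?_
    have h4 : 0 < 4 ^ k := by positivity
    simp only [lp.coeFn_smul, Pi.smul_apply, smul_eq_mul, flipOp_apply, Nat.zero_le, if_true,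
      Nat.sub_zero, unilateralShift_pow_apply, lp.single_apply, Pi.single_apply]
    by_cases h : n + 1 = 4 ^ k
    · have h' : ((n : ℂ) + 1) = 4 ^ k := by exact_mod_cast h
      rw [if_pos h, if_pos (by omega), if_pos (by omega)]
      push_cast
      rw [h']
      field_simp
    · rw [if_neg h]
      split_ifs
      · omega
      · simp
      · simp

lemma le_norm_aeval_foguelHankel (δ : ℝ) (hδ : 0 ≤ δ) (m : ℕ) (p : ℂ[X]) :
    δ * ‖∑ k ∈ Finset.range m, p.coeff (4 ^ k)‖ ≤ ‖aeval (foguelHankel δ m) p‖ := by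
  set v : WithLp 2 (EllTwo × EllTwo) := WithLp.toLp 2 ((0 : EllTwo), lp.single 2 0 (1 : ℂ))
  have hv : ‖v‖ = 1 := by
    rw [WithLp.norm_toLp_snd, lp.norm_single (by norm_num), norm_one]
  have h1 : (aeval (foguelHankel δ m) p v).fst 0 =
      δ * ∑ k ∈ Finset.range m, p.coeff (4 ^ k) := by
    induction p using Polynomial.induction_on' with
    | add p q hp hq =>
      simp only [map_add, add_apply, WithLp.add_fst, lp.coeFn_add, Pi.add_apply, hp, hq,
        coeff_add, Finset.sum_add_distrib, mul_add]
    | monomial n a =>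
      rw [aeval_monomial, ← Algebra.smul_def, smul_apply, WithLp.smul_fst, lp.coeFn_smul,
        Pi.smul_apply, foguelHankel_pow_corner, smul_eq_mul, mul_left_comm, Finset.mul_sum]
      simp [coeff_monomial]
  have h2 : ‖(aeval (foguelHankel δ m) p v).fst 0‖ ≤ ‖aeval (foguelHankel δ m) p‖ := by
    refine (lp.norm_apply_le_norm (by norm_num) _ 0).trans ((WithLp.norm_fst_le _ _).trans ?_)
    simpa [hv] using (aeval (foguelHankel δ m) p).le_opNorm v
  rwa [h1, norm_mul, Complex.norm_real, Real.norm_of_nonneg hδ] at h2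

/-! ### No power bounded weighted shift dominates -/

lemma norm_aeval_conj {H G : Type*} [NormedAddCommGroup H] [NormedSpace ℂ H]
    [NormedAddCommGroup G] [NormedSpace ℂ G] (e : H ≃ₗᵢ[ℂ] G) (A : H →L[ℂ] H) (B : G →L[ℂ] G)
    (h : ∀ x, e (A x) = B (e x)) (p : ℂ[X]) : ‖aeval A p‖ = ‖aeval B p‖ := by
  have h1 : ∀ x, e (aeval A p x) = aeval B p (e x) :=
    LinearMap.map_aeval_of_commL (e : H →ₗ[ℂ] G) A B h p
  refine le_antisymm ?_ ?_
  · refine ContinuousLinearMap.opNorm_le_bound _ (norm_nonneg _) fun x => ?_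
    rw [← e.norm_map (aeval A p x), h1, ← e.norm_map x]
    exact ContinuousLinearMap.le_opNorm _ _
  · refine ContinuousLinearMap.opNorm_le_bound _ (norm_nonneg _) fun y => ?_
    obtain ⟨x, rfl⟩ := e.surjective y
    rw [← h1, e.norm_map, e.norm_map]
    exact ContinuousLinearMap.le_opNorm _ _

theorem not_dominated_by_weightedForwardShift (K : ℝ) (hK : 1 < K) (E : EllTwo →L[ℂ] EllTwo)
    (hE : IsWeightedForwardShift E) (hpb : IsPowerBounded E)
    (hdom : ∀ (H : Type u) [NormedAddCommGroup H] [InnerProductSpace ℂ H] [CompleteSpace H]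
      (A : H →L[ℂ] H), (∀ n : ℕ, ‖A ^ n‖ ≤ K) → ∀ f : ℂ[X], ‖aeval A f‖ ≤ ‖aeval E f‖) : False := by
  obtain ⟨w, hw, rfl⟩ := hE
  obtain ⟨M, hM⟩ := hpb
  have hM0 : 0 ≤ M := (norm_nonneg _).trans (hM 0)
  set E := weightedForwardShift w hw
  -- Small enough that the power bound `1 + 4 δ / 3` is at most `K`.
  set δ := (K - 1) / 2 with hδ
  have hδ0 : 0 < δ := by rw [hδ]; linarith
  have hfog : ∀ (m : ℕ) (f : ℂ[X]), ‖aeval (foguelHankel δ m) f‖ ≤ ‖aeval E f‖ := by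
    intro m f
    -- Adding a zero summand from universe `u` transports the operator to a space to which `hdom`
    -- applies.
    let e := LinearIsometryEquiv.withLpProdUnique 2 ℂ (WithLp 2 (EllTwo × EllTwo))
      (EuclideanSpace ℂ PEmpty.{u + 1})
    let A : WithLp 2 (WithLp 2 (EllTwo × EllTwo) × EuclideanSpace ℂ PEmpty.{u + 1}) →L[ℂ]
        WithLp 2 (WithLp 2 (EllTwo × EllTwo) × EuclideanSpace ℂ PEmpty.{u + 1}) :=
      (e.symm.toContinuousLinearEquiv : _ →L[ℂ] _) ∘L foguelHankel δ m ∘L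
        (e.toContinuousLinearEquiv : _ →L[ℂ] _)
    have hA : ∀ x, e (A x) = foguelHankel δ m (e x) := fun x => e.apply_symm_apply _
    rw [← norm_aeval_conj e A _ hA]
    refine hdom _ A (fun n => ?_) f
    have h1 := norm_aeval_conj e A _ hA (X ^ n)
    simp only [map_pow, aeval_X] at h1
    rw [h1]
    refine (norm_foguelHankel_pow_le hδ0.le m n).trans ?_
    rw [hδ]
    linarith
  obtain ⟨m, hm⟩ := exists_nat_gt ((4 * M / δ) ^ 2)
  have hmR : (0 : ℝ) < m := (sq_nonneg _).trans_lt hm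
  obtain ⟨p, hp2, hpc⟩ := exists_bounded_polynomial_large_coeff_sum m (by exact_mod_cast hmR)
  -- So close to `1` that, by Bernoulli, dilating by `r` at most halves the coefficients up to index
  -- `4 ^ m`.
  set r : ℝ := 1 - 1 / (2 * 4 ^ m) with hr
  have h4m : (1 : ℝ) ≤ 4 ^ m := one_le_pow₀ (by norm_num)
  have hx : 1 / (2 * (4 : ℝ) ^ m) ≤ 1 / 2 := one_div_le_one_div_of_le (by norm_num) (by linarith)
  have hx0 : 0 < 1 / (2 * (4 : ℝ) ^ m) := by positivity
  have hr0 : 0 ≤ r := by rw [hr]; linarith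
  have hr1 : r < 1 := by rw [hr]; linarith
  have hrm : 1 / 2 ≤ r ^ 4 ^ m := by
    have h1 := one_add_mul_le_pow (a := -(1 / (2 * (4 : ℝ) ^ m))) (by linarith) (4 ^ m)
    rw [← sub_eq_add_neg, ← hr] at h1
    refine le_trans (le_of_eq ?_) h1
    push_cast
    field_simp
    norm_num
  let f : ℂ[X] := p.comp (C (r : ℂ) * X)
  have hf1 : ‖aeval E f‖ ≤ M * 2 := by
    have : aeval E f = aeval ((r : ℂ) • E) p := by
      simp only [f, aeval_comp, map_mul, aeval_C, aeval_X, Algebra.smul_def]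
    rw [this]
    exact (norm_aeval_smul_le_unilateralShift hw hM hr0 hr1 p).trans
      (mul_le_mul_of_nonneg_left hp2 hM0)
  have hs0 : 0 < √(m : ℝ) := Real.sqrt_pos.2 hmR
  have hf2 : √m / 2 ≤ ‖∑ k ∈ Finset.range m, f.coeff (4 ^ k)‖ := by
    have h1 : ∑ k ∈ Finset.range m, f.coeff (4 ^ k) =
        ((∑ k ∈ Finset.range m, (√m)⁻¹ * r ^ 4 ^ k : ℝ) : ℂ) := by
      push_cast
      refine Finset.sum_congr rfl fun k hk => ?_
      simp only [f, comp_C_mul_X_coeff, hpc k (Finset.mem_range.1 hk)]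
      push_cast
      rfl
    rw [h1, Complex.norm_real]
    refine le_trans ?_ (Real.le_norm_self _)
    have h2 : ∀ k ∈ Finset.range m, (√m)⁻¹ * (1 / 2) ≤ (√m)⁻¹ * r ^ 4 ^ k := by
      intro k hk
      refine mul_le_mul_of_nonneg_left (hrm.trans ?_) (by positivity)
      exact pow_le_pow_of_le_one hr0 hr1.le
        (Nat.pow_le_pow_right (by norm_num) (Finset.mem_range.1 hk).le)
    refine le_trans (le_of_eq ?_) (Finset.sum_le_sum h2)
    rw [Finset.sum_const, Finset.card_range, nsmul_eq_mul]
    field_simp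
    exact Real.sq_sqrt hmR.le
  have h3 : δ * (√m / 2) ≤ M * 2 :=
    (mul_le_mul_of_nonneg_left hf2 hδ0.le).trans
      ((le_norm_aeval_foguelHankel δ hδ0.le m f).trans ((hfog m f).trans hf1))
  have h4 : 4 * M / δ < √m := Real.lt_sqrt_of_sq_lt hm
  rw [div_lt_iff₀ hδ0] at h4
  linarith

theorem theorem2p3 (K : ℝ) (hK : 1 < K) :
    (∀ (H : Type u) [NormedAddCommGroup H] [InnerProductSpace ℂ H] [CompleteSpace H]
        (T : H →L[ℂ] H), (∀ n : ℕ, ‖T ^ n‖ ≤ K) →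
        ∀ p : ℂ[X], ‖aeval T p‖ ≤ ‖aeval (extremalShift K hK) p‖) ∧
    ¬ ∃ E : EllTwo →L[ℂ] EllTwo, IsWeightedForwardShift E ∧ IsPowerBounded E ∧
        ∀ (H : Type u) [NormedAddCommGroup H] [InnerProductSpace ℂ H] [CompleteSpace H]
          (A : H →L[ℂ] H), (∀ n : ℕ, ‖A ^ n‖ ≤ K) →
          ∀ f : ℂ[X], ‖aeval A f‖ ≤ ‖aeval E f‖ := by
  refine ⟨fun H _ _ _ T hT p => norm_aeval_le_extremalShift hK T hT p, ?_⟩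
  rintro ⟨E, hE, hpb, hdom⟩
  exact not_dominated_by_weightedForwardShift K hK E hE hpb hdom
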